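/- Let $m,n\in\mathbb N$. For $i=1,\dots,m$ let $f_i:\mathbb R^n\to\mathbb R$ be convex and let $X_i\subset\mathbb R^n$ be compact and convex, such that $\bigcap_{i=1}^m X_i$ has non-empty interior and the subgradients of $f=\sum_{i=1}^m f_i$ are bounded on $\bigcup_{i=1}^m X_i$, i.e. $\sup\{\|\xi\|_2:\ \xi\in\partial f(x),\ x\in\bigcup_{i=1}^m X_i\}<\infty$. Let $x^\star$ denote a minimiser of $f$ over $\bigcap_{i=1}^m X_i$. Let $(A(k))_{k\ge 0}$ be doubly stochastic real $m\times m$ matrices, $[A(k)]_j^i$ being the entry in row $j$ and column $i$, for which there are $\theta\in(0,1)$ and $T\in\mathbb N$ such that: for all $k,i,j$, $[A(k)]_i^i\ge\theta$, and $[A(k)]_j^i\ge\theta$ whenever $[A(k)]_j^i>0$; the graph $(\{1,\dots,m\},\mathcal E_\infty)$, where $(j,i)\in\mathcal E_\infty$ iff $[A(k)]_j^i>0$ for infinitely many $k$, is strongly connected; and for every $(j,i)\in\mathcal E_\infty$ and every $k\ge 0$ there is $l\in\{k,\dots,k+T-1\}$ with $[A(l)]_j^i>0$. Let $\eta>0$,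 $c(k)=\eta/\sqrt{k+1}$, and let $x_i(k)$, $k\ge 0$, $i=1,\dots,m$, be generated by: $x_i(0)\in X_i$ arbitrary and, for $k\ge0$, $$z_i(k)=\sum_{j=1}^m[A(k)]_j^i\,x_j(k),\qquad g_i(k)\in\partial f_i(z_i(k)),\qquad d_i(k)=\sum_{j=1}^m[A(k)]_j^i\,g_j(k),$$ $$x_i(k+1)=\operatorname*{arg\,min}_{\xi\in X_i}\ d_i(k)^{\mathsf T}\xi+\frac1{2c(k)}\|z_i(k)-\xi\|_2^2 .$$ Put $S(k)=\sum_{r=1}^k c(r)$, $\hat x_i(0)=x_i(0)$ and $\hat x_i(k+1)=\dfrac{c(k+1)\,x_i(k+1)+S(k)\,\hat x_i(k)}{S(k+1)}$. Then: (i) for all $i,j$, $\|\hat x_i(k)-\hat x_j(k)\|_2\to0$ as $k\to\infty$, and $\|\hat x_i(k)-\hat x_j(k)\|_2=O\!\left(\frac{\ln k}{\sqrt k}\right)$; (ii) for all $i$, every accumulation point of $(\hat x_i(k))_k$ lies in $\bigcap_{j=1}^m X_j$; (iii) there exist $B_1,B_2>0$, depending only on the $f_i$, the $X_i$, $\eta$,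 $\theta$ and $T$ (not on the matrices, the initial points or the choice of subgradients), such that for all $k\ge1$ and every minimiser $x^\star$, $$\left|\sum_{i=1}^m f_i(\hat x_i(k))-f(x^\star)\right|\le \frac{B_1}{\sqrt k}+B_2\,\frac{\ln k}{\sqrt k}.$$ -/

import Mathlib

open Filter Topology Asymptotics

noncomputable section

namespace DistributedSubgradient

/-- The convex subdifferential of a finite function `f` at `x`. -/
def subdifferential {n : ℕ} (f : EuclideanSpace ℝ (Fin n) → ℝ) (x : EuclideanSpace ℝ (Fin n)) :
    Set (EuclideanSpace ℝ (Fin n)) :=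
  {ξ | ∀ y, f x + inner ℝ ξ (y - x) ≤ f y}

/-- The global objective `f = ∑ i, f i`. -/
def objective {n m : ℕ} (f : Fin m → EuclideanSpace ℝ (Fin n) → ℝ)
    (x : EuclideanSpace ℝ (Fin n)) : ℝ :=
  ∑ i, f i x

/-- The standing assumptions on the problem
`minimise ∑ i, f i x` subject to `x ∈ ⋂ i, X i`. -/
structure ConvexCompactProblem {n m : ℕ} (f : Fin m → EuclideanSpace ℝ (Fin n) → ℝ)
    (X : Fin m → Set (EuclideanSpace ℝ (Fin n))) : Prop where
  convex_objective : ∀ i, ConvexOn ℝ Set.univ (f i)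
  compact_constraint : ∀ i, IsCompact (X i)
  convex_constraint : ∀ i, Convex ℝ (X i)
  interior_nonempty : (interior (⋂ i, X i)).Nonempty
  bounded_subgradient : ∃ L : ℝ, ∀ x ∈ ⋃ i, X i, ∀ ξ ∈ subdifferential (objective f) x, ‖ξ‖ ≤ L

/-- `xstar` is an optimiser: a feasible point that minimises the objective over the feasible set. -/
def IsOptimiser {n m : ℕ} (f : Fin m → EuclideanSpace ℝ (Fin n) → ℝ)
    (X : Fin m → Set (EuclideanSpace ℝ (Fin n))) (xstar : EuclideanSpace ℝ (Fin n)) : Prop :=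
  xstar ∈ ⋂ i, X i ∧ ∀ x ∈ ⋂ i, X i, objective f xstar ≤ objective f x

/-- Agent `j` communicates with agent `i` at time `k`; the entry of `A k` in row `j` and
column `i` is the weight that `i` gives to the information of `j`. -/
def Communicates {m : ℕ} (A : ℕ → Matrix (Fin m) (Fin m) ℝ) (k : ℕ) (j i : Fin m) : Prop :=
  0 < A k j i

/-- `(j, i)` is an edge of the limiting graph: `j` communicates with `i` infinitely often. -/
def CommunicatesInfinitelyOften {m : ℕ} (A : ℕ → Matrix (Fin m) (Fin m) ℝ) (j i : Fin m) : Prop :=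
  ∃ᶠ k in atTop, Communicates A k j i

/-- The assumptions on the time-varying network, with lower bound `θ` on the positive weights
and uniform upper bound `T` on the communication times. -/
structure NetworkAssumptions {m : ℕ} (A : ℕ → Matrix (Fin m) (Fin m) ℝ) (θ : ℝ) (T : ℕ) :
    Prop where
  strongly_connected : ∀ j i, Relation.ReflTransGen (CommunicatesInfinitelyOften A) j i
  bounded_communication : ∀ j i, CommunicatesInfinitelyOften A j i →
    ∀ k, ∃ l, k ≤ l ∧ l < k + T ∧ Communicates A l j i
  diagonal_lower_bound : ∀ k i, θ ≤ A k i i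
  positive_lower_bound : ∀ k j i, 0 < A k j i → θ ≤ A k j i
  doubly_stochastic : ∀ k, A k ∈ doublyStochastic ℝ (Fin m)

/-- The sequences `x, z, g, d` (time first, then agent) are generated by the
subgradient averaging algorithm with weights `A` and step sizes `c`. -/
structure IsAlgorithmRun {n m : ℕ} (f : Fin m → EuclideanSpace ℝ (Fin n) → ℝ)
    (X : Fin m → Set (EuclideanSpace ℝ (Fin n))) (A : ℕ → Matrix (Fin m) (Fin m) ℝ) (c : ℕ → ℝ)
    (x z g d : ℕ → Fin m → EuclideanSpace ℝ (Fin n)) : Prop where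
  init : ∀ i, x 0 i ∈ X i
  average : ∀ k i, z k i = ∑ j, A k j i • x k j
  subgradient : ∀ k i, g k i ∈ subdifferential (f i) (z k i)
  average_subgradient : ∀ k i, d k i = ∑ j, A k j i • g k j
  update_mem : ∀ k i, x (k + 1) i ∈ X i
  update_argmin : ∀ k i,
    IsMinOn (fun ξ => inner ℝ (d k i) ξ + 1 / (2 * c k) * ‖z k i - ξ‖ ^ 2) (X i) (x (k + 1) i)

/-- The step size `c(k) = η / √(k + 1)`. -/
def stepSize (η : ℝ) (k : ℕ) : ℝ := η / √((k : ℝ) + 1)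

/-- `S(k) = c(1) + ⋯ + c(k)`. -/
def stepSum (c : ℕ → ℝ) (k : ℕ) : ℝ := ∑ r ∈ Finset.Icc 1 k, c r

/-- The weighted running average of a sequence `y`, started at `y 0`. -/
def runningAverage {n : ℕ} (c : ℕ → ℝ) (y : ℕ → EuclideanSpace ℝ (Fin n)) :
    ℕ → EuclideanSpace ℝ (Fin n)
  | 0 => y 0
  | k + 1 => (stepSum c (k + 1))⁻¹ •
      (c (k + 1) • y (k + 1) + stepSum c k • runningAverage c y k)

end DistributedSubgradient

end

/-! Two scalar sequences govern a run: `spread (x k)`, the disagreement δ, and `updateError x z k`,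
the size ε of the proximal correction. Since `z k i` need not lie in `X i`, ε is not O(c) a priori,
so both must be controlled together.

The network contracts δ by a fixed factor over windows of `m * T` steps, up to the errors ε
(`spread_add_le`), so ∑ δ² ≤ C₁ + C₂ ∑ ε² (`sum_sq_le_of_window_contraction`). The interior point of
the intersection gives feasible points w(k) within K·δ(k) of all agents
(`exists_mem_iInter_norm_sub_le`). Summing the proximal inequality over agents yields, with V the
sum of squared distances to an optimiser p and C a constant, ε² + 2c(f(w) - f(p)) + V(k+1) ≤ V(k) +
2cC(δ + ε) (`IsAlgorithmRun.descent`). Feasibility of w makes the gap nonnegative, and Young's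
inequality absorbs δ and ε on the right into ε² on the left. Hence ∑ c(f(w) - f(p)) and ∑ cδ are O(1
+ ∑ c²) (`exists_bound_of_descent`).

For c = η/√(k+1), ∑ c² is O(1 + log k) while S(k) is at least of order √k. By Jensen the running
average of w is feasible, nearly optimal and close to every x̂ᵢ at rate (1 + log k)/√k. All three
claims follow by comparison with it, and every constant is fixed before the run is chosen. -/

namespace DistributedSubgradient

/-! ### Products of the weight matrices -/

/-- The entry in row `j` and column `i` of `transition A s t` is the weight of the state of `j` at
time `s` in the state of `i` at time `s + t`. -/
def transition {m : ℕ} (A : ℕ → Matrix (Fin m) (Fin m) ℝ) (s : ℕ) :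
    ℕ → Matrix (Fin m) (Fin m) ℝ
  | 0 => 1
  | t + 1 => transition A s t * A (s + t)

theorem transition_mem_doublyStochastic {m : ℕ} {A : ℕ → Matrix (Fin m) (Fin m) ℝ}
    (hA : ∀ k, A k ∈ doublyStochastic ℝ (Fin m)) (s t : ℕ) :
    transition A s t ∈ doublyStochastic ℝ (Fin m) := by
  induction t with
  | zero => exact one_mem _
  | succ t ih => exact mul_mem ih (hA _)

theorem mul_le_transition_succ {m : ℕ} {A : ℕ → Matrix (Fin m) (Fin m) ℝ}
    (hA : ∀ k, A k ∈ doublyStochastic ℝ (Fin m)) {s t : ℕ} {θ b : ℝ} (hθ : 0 ≤ θ)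
    {j l i : Fin m} (hl : b ≤ transition A s t j l)
    (hli : θ ≤ A (s + t) l i) : b * θ ≤ transition A s (t + 1) j i := by
  have hΦ := transition_mem_doublyStochastic hA s t
  calc b * θ ≤ transition A s t j l * A (s + t) l i :=
        mul_le_mul hl hli hθ (nonneg_of_mem_doublyStochastic hΦ)
    _ ≤ ∑ l, transition A s t j l * A (s + t) l i :=
        Finset.single_le_sum (f := fun l => transition A s t j l * A (s + t) l i)
          (fun l _ => mul_nonneg (nonneg_of_mem_doublyStochastic hΦ)
            (nonneg_of_mem_doublyStochastic (hA _))) (Finset.mem_univ l)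
    _ = transition A s (t + 1) j i := by rw [transition, Matrix.mul_apply]

theorem pow_le_transition_add {m : ℕ} {A : ℕ → Matrix (Fin m) (Fin m) ℝ} {θ : ℝ} {T : ℕ}
    (hA : NetworkAssumptions A θ T) (hθ : 0 ≤ θ) {s t : ℕ} {j i : Fin m}
    (h : θ ^ t ≤ transition A s t j i) (a : ℕ) :
    θ ^ (t + a) ≤ transition A s (t + a) j i := by
  induction a with
  | zero => exact h
  | succ a ih =>
    rw [← add_assoc, pow_succ]
    exact mul_le_transition_succ hA.doubly_stochastic hθ ih (hA.diagonal_lower_bound _ _)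

/-- The weight waits at `l` through the diagonal entries until the edge is used, crosses it, then
waits at `i` for the rest of the window; each of the `T` steps costs at most a factor `θ`. -/
theorem pow_le_transition_of_edge {m : ℕ} {A : ℕ → Matrix (Fin m) (Fin m) ℝ} {θ : ℝ} {T : ℕ}
    (hA : NetworkAssumptions A θ T) (hθ : 0 ≤ θ) {s t : ℕ} {j l i : Fin m}
    (h : θ ^ t ≤ transition A s t j l) (hli : CommunicatesInfinitelyOften A l i) :
    θ ^ (t + T) ≤ transition A s (t + T) j i := by
  obtain ⟨r, hr, hrT, hc⟩ := hA.bounded_communication l i hli (s + t)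
  obtain ⟨a, rfl⟩ := Nat.exists_eq_add_of_le hr
  obtain ⟨b, rfl⟩ : ∃ b, T = a + 1 + b := Nat.exists_eq_add_of_le (by omega)
  have h1 := pow_le_transition_add hA hθ h a
  have h2 := mul_le_transition_succ (i := i) hA.doubly_stochastic hθ h1
    (hA.positive_lower_bound _ _ _ (by rw [← add_assoc]; exact hc))
  rw [← pow_succ] at h2
  have h3 := pow_le_transition_add hA hθ h2 b
  rwa [show t + a + 1 + b = t + (a + 1 + b) by ring] at h3

theorem exists_exit_edge {α : Type*} {r : α → α → Prop} {S : Set α} {a b : α}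
    (h : Relation.ReflTransGen r a b) (ha : a ∈ S) (hb : b ∉ S) :
    ∃ c ∈ S, ∃ d ∉ S, r c d := by
  induction h with
  | refl => exact absurd ha hb
  | @tail c d _ hcd ih =>
    by_cases hc : c ∈ S
    · exact ⟨c, hc, d, hb, hcd⟩
    · exact ih hc

/-- After `m * T` steps every agent has received a uniformly positive weight from every other. -/
theorem pow_le_transition {m : ℕ} {A : ℕ → Matrix (Fin m) (Fin m) ℝ} {θ : ℝ} {T : ℕ}
    (hA : NetworkAssumptions A θ T) (hθ : 0 ≤ θ) (s : ℕ) (j i : Fin m) :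
    θ ^ (m * T) ≤ transition A s (m * T) j i := by
  classical
  let R : ℕ → Finset (Fin m) := fun p =>
    Finset.univ.filter fun i => θ ^ (p * T) ≤ transition A s (p * T) j i
  have hmem : ∀ p i, i ∈ R p ↔ θ ^ (p * T) ≤ transition A s (p * T) j i := by simp [R]
  have hj : ∀ p, j ∈ R p := fun p => by
    rw [hmem]
    simpa using pow_le_transition_add hA hθ (s := s) (t := 0) (j := j) (i := j)
      (by simp [transition]) (p * T)
  have hsub : ∀ p, R p ⊆ R (p + 1) := fun p i hi => by
    rw [hmem] at hi ⊢
    simpa only [add_mul, one_mul] using pow_le_transition_add hA hθ hi T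
  -- Strong connectivity gives an edge leaving `R p` while it is not everything, so each block of
  -- `T` steps reaches a new agent and `m` blocks suffice.
  have hcard : ∀ p, min p m ≤ (R p).card := by
    intro p
    induction p with
    | zero => simp
    | succ p ih =>
      by_cases hu : R p = Finset.univ
      · have := Finset.card_le_card (hsub p)
        rw [hu, Finset.card_univ, Fintype.card_fin] at this
        exact (min_le_right _ _).trans this
      · obtain ⟨b, hb⟩ : ∃ b, b ∉ R p := by
          by_contra! h
          exact hu (Finset.eq_univ_iff_forall.2 h)
        obtain ⟨c, hc, e, he, hce⟩ :=
          exists_exit_edge (S := (R p : Set (Fin m))) (hA.strongly_connected j b) (hj p) hb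
        have he' : e ∈ R (p + 1) := by
          rw [hmem, add_mul, one_mul]
          exact pow_le_transition_of_edge hA hθ ((hmem _ _).1 hc) hce
        have := Finset.card_le_card (Finset.insert_subset he' (hsub p))
        rw [Finset.card_insert_of_notMem he] at this
        omega
  have hm : R m = Finset.univ := by
    rw [← Finset.card_eq_iff_eq_univ, Fintype.card_fin]
    refine le_antisymm ?_ (by simpa using hcard m)
    simpa using Finset.card_le_univ (R m)
  exact (hmem m i).1 (hm ▸ Finset.mem_univ i)

/-! ### Contraction of the disagreement -/

/-- The largest distance between two members of a finite family. -/
noncomputable def spread {m : ℕ} {E : Type*} [NormedAddCommGroup E] (y : Fin m → E) : ℝ :=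
  ⨆ p : Fin m × Fin m, ‖y p.1 - y p.2‖

theorem norm_sub_le_spread {m : ℕ} {E : Type*} [NormedAddCommGroup E] (y : Fin m → E)
    (i j : Fin m) : ‖y i - y j‖ ≤ spread y :=
  le_ciSup (f := fun p : Fin m × Fin m => ‖y p.1 - y p.2‖) (Set.finite_range _).bddAbove (i, j)

theorem spread_nonneg {m : ℕ} {E : Type*} [NormedAddCommGroup E] (y : Fin m → E) :
    0 ≤ spread y :=
  Real.iSup_nonneg fun _ => norm_nonneg _

theorem spread_le {m : ℕ} {E : Type*} [NormedAddCommGroup E] {y : Fin m → E} {D : ℝ}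
    (hD : 0 ≤ D) (h : ∀ i j, ‖y i - y j‖ ≤ D) : spread y ≤ D :=
  Real.iSup_le (fun p => h p.1 p.2) hD

/-- Scaled by `σ`, the difference is a double sum of `y j - y l` with the product weights `a j * b
l`, of total mass `σ ^ 2`. Masses `σ < 1` are what produce a contraction. -/
theorem norm_sum_smul_sub_sum_smul_le {m : ℕ} {E : Type*} [NormedAddCommGroup E]
    [NormedSpace ℝ E] (y : Fin m → E) {a b : Fin m → ℝ} {σ : ℝ} (ha : ∀ j, 0 ≤ a j)
    (hb : ∀ j, 0 ≤ b j) (has : ∑ j, a j = σ) (hbs : ∑ j, b j = σ) :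
    ‖∑ j, a j • y j - ∑ j, b j • y j‖ ≤ σ * spread y := by
  have hσ : 0 ≤ σ := has ▸ Finset.sum_nonneg fun j _ => ha j
  rcases hσ.eq_or_lt with h0 | hpos
  · subst h0
    have ha0 := (Finset.sum_eq_zero_iff_of_nonneg fun j _ => ha j).1 has
    have hb0 := (Finset.sum_eq_zero_iff_of_nonneg fun j _ => hb j).1 hbs
    have h1 : ∑ j, a j • y j = 0 := Finset.sum_eq_zero fun j hj => by rw [ha0 j hj, zero_smul]
    have h2 : ∑ j, b j • y j = 0 := Finset.sum_eq_zero fun j hj => by rw [hb0 j hj, zero_smul]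
    simp [h1, h2]
  · have key : σ • (∑ j, a j • y j - ∑ j, b j • y j)
        = ∑ j, ∑ l, (a j * b l) • (y j - y l) := by
      simp_rw [smul_sub, Finset.sum_sub_distrib]
      congr 1
      · simp_rw [← Finset.sum_smul, ← Finset.mul_sum, hbs, Finset.smul_sum, smul_smul]
        simp_rw [mul_comm]
      · rw [Finset.sum_comm]
        simp_rw [← Finset.sum_smul, ← Finset.sum_mul, has, Finset.smul_sum, smul_smul]
    have hn : σ * ‖∑ j, a j • y j - ∑ j, b j • y j‖ ≤ σ * (σ * spread y) := by
      calc σ * ‖∑ j, a j • y j - ∑ j, b j • y j‖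
          = ‖∑ j, ∑ l, (a j * b l) • (y j - y l)‖ := by
            rw [← key, norm_smul, Real.norm_of_nonneg hσ]
        _ ≤ ∑ j, ∑ l, (a j * b l) * spread y := by
            refine (norm_sum_le _ _).trans (Finset.sum_le_sum fun j _ =>
              (norm_sum_le _ _).trans (Finset.sum_le_sum fun l _ => ?_))
            rw [norm_smul, Real.norm_of_nonneg (mul_nonneg (ha j) (hb l))]
            exact mul_le_mul_of_nonneg_left (norm_sub_le_spread y j l)
              (mul_nonneg (ha j) (hb l))
        _ = σ * (σ * spread y) := by
            simp_rw [← Finset.sum_mul, ← Finset.mul_sum, hbs, ← Finset.sum_mul, has]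
            ring
    exact le_of_mul_le_mul_left hn hpos

/-- Unrolling the perturbed averaging recursion: past errors are only averaged, with column sums
one, and so are never amplified. -/
theorem norm_sub_transition_le {m : ℕ} {E : Type*} [NormedAddCommGroup E] [NormedSpace ℝ E]
    {A : ℕ → Matrix (Fin m) (Fin m) ℝ} (hA : ∀ k, A k ∈ doublyStochastic ℝ (Fin m))
    {x : ℕ → Fin m → E} {ε : ℕ → ℝ} (hx : ∀ k i, ‖x (k + 1) i - ∑ j, A k j i • x k j‖ ≤ ε k)
    (s t : ℕ) (i : Fin m) :
    ‖x (s + t) i - ∑ j, transition A s t j i • x s j‖ ≤ ∑ r ∈ Finset.range t, ε (s + r) := by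
  induction t generalizing i with
  | zero => simp [transition, Matrix.one_apply]
  | succ t ih =>
    have key : x (s + (t + 1)) i - ∑ j, transition A s (t + 1) j i • x s j
        = (∑ l, A (s + t) l i • (x (s + t) l - ∑ j, transition A s t j l • x s j))
          + (x (s + t + 1) i - ∑ l, A (s + t) l i • x (s + t) l) := by
      simp_rw [transition, Matrix.mul_apply, smul_sub, Finset.sum_sub_distrib, Finset.smul_sum,
        Finset.sum_smul, smul_smul]
      rw [Finset.sum_comm]
      simp_rw [mul_comm (transition A s t _ _)]
      rw [← add_assoc]
      abel
    rw [key, Finset.sum_range_succ]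
    refine (norm_add_le _ _).trans (add_le_add ?_ (hx _ _))
    calc ‖∑ l, A (s + t) l i • (x (s + t) l - ∑ j, transition A s t j l • x s j)‖
        ≤ ∑ l, A (s + t) l i * ∑ r ∈ Finset.range t, ε (s + r) := by
          refine (norm_sum_le _ _).trans (Finset.sum_le_sum fun l _ => ?_)
          rw [norm_smul, Real.norm_of_nonneg (nonneg_of_mem_doublyStochastic (hA _))]
          exact mul_le_mul_of_nonneg_left (ih l) (nonneg_of_mem_doublyStochastic (hA _))
      _ = _ := by
          rw [← Finset.sum_mul, sum_col_of_mem_doublyStochastic (hA _), one_mul]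

/-- All entries of the window product are at least `β`, so this common part cancels in the
difference of two columns, leaving mass `1 - m * β`, at most `1 - β` because an agent exists. Each
of the two agents compared contributes one accumulated error, hence the factor 2. -/
theorem spread_add_le {m : ℕ} {E : Type*} [NormedAddCommGroup E] [NormedSpace ℝ E]
    {A : ℕ → Matrix (Fin m) (Fin m) ℝ} {θ : ℝ} {T : ℕ}
    (hA : NetworkAssumptions A θ T) (hθ : θ ∈ Set.Ioo (0 : ℝ) 1)
    {x : ℕ → Fin m → E} {ε : ℕ → ℝ} (hε : ∀ k, 0 ≤ ε k)
    (hx : ∀ k i, ‖x (k + 1) i - ∑ j, A k j i • x k j‖ ≤ ε k) (s : ℕ) :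
    spread (x (s + m * T)) ≤ (1 - θ ^ (m * T)) * spread (x s)
      + 2 * ∑ r ∈ Finset.range (m * T), ε (s + r) := by
  set β := θ ^ (m * T) with hβ
  have hβ0 : 0 < β := pow_pos hθ.1 _
  have hβ1 : β ≤ 1 := pow_le_one₀ hθ.1.le hθ.2.le
  have hsum : 0 ≤ ∑ r ∈ Finset.range (m * T), ε (s + r) := Finset.sum_nonneg fun r _ => hε _
  have hs := spread_nonneg (x s)
  refine spread_le (by have := mul_nonneg (sub_nonneg.2 hβ1) hs; linarith) fun i i' => ?_
  have hΦ := transition_mem_doublyStochastic hA.doubly_stochastic s (m * T)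
  have h1 := norm_sub_transition_le hA.doubly_stochastic hx s (m * T) i
  have h2 := norm_sub_transition_le hA.doubly_stochastic hx s (m * T) i'
  have hm : (1 : ℝ) ≤ m := by exact_mod_cast i.pos
  have hcol : ∀ i, ∑ j, (transition A s (m * T) j i - β) = 1 - m * β := fun i => by
    rw [Finset.sum_sub_distrib, sum_col_of_mem_doublyStochastic hΦ]
    simp
  have h3 := norm_sum_smul_sub_sum_smul_le (x s)
    (a := fun j => transition A s (m * T) j i - β) (b := fun j => transition A s (m * T) j i' - β)
    (fun j => sub_nonneg.2 (pow_le_transition hA hθ.1.le s j i))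
    (fun j => sub_nonneg.2 (pow_le_transition hA hθ.1.le s j i')) (hcol i) (hcol i')
  have h4 : ∑ j, (transition A s (m * T) j i - β) • x s j
      - ∑ j, (transition A s (m * T) j i' - β) • x s j
      = ∑ j, transition A s (m * T) j i • x s j - ∑ j, transition A s (m * T) j i' • x s j := by
    simp_rw [sub_smul, Finset.sum_sub_distrib]
    abel
  rw [h4] at h3
  have h5 : (1 - m * β) * spread (x s) ≤ (1 - β) * spread (x s) :=
    mul_le_mul_of_nonneg_right (by nlinarith) hs
  have h6 : x (s + m * T) i - x (s + m * T) i'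
      = (x (s + m * T) i - ∑ j, transition A s (m * T) j i • x s j)
        + (∑ j, transition A s (m * T) j i • x s j - ∑ j, transition A s (m * T) j i' • x s j)
        - (x (s + m * T) i' - ∑ j, transition A s (m * T) j i' • x s j) := by abel
  rw [h6]
  have h7 := norm_sub_le
    ((x (s + m * T) i - ∑ j, transition A s (m * T) j i • x s j)
      + (∑ j, transition A s (m * T) j i • x s j - ∑ j, transition A s (m * T) j i' • x s j))
    (x (s + m * T) i' - ∑ j, transition A s (m * T) j i' • x s j)
  have h8 := norm_add_le (x (s + m * T) i - ∑ j, transition A s (m * T) j i • x s j)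
    (∑ j, transition A s (m * T) j i • x s j - ∑ j, transition A s (m * T) j i' • x s j)
  linarith

/-- A nonnegative sequence that contracts by a fixed factor over windows of length `B`, up to
errors `ε`, has partial sums of squares controlled by those of the errors. -/
theorem sum_sq_le_of_window_contraction {u ε : ℕ → ℝ} {β D : ℝ} {B : ℕ} (hβ0 : 0 < β)
    (hβ1 : β ≤ 1) (hu : ∀ k, 0 ≤ u k) (huD : ∀ k, u k ≤ D) (hε : ∀ k, 0 ≤ ε k)
    (h : ∀ s, u (s + B) ≤ (1 - β) * u s + 2 * ∑ r ∈ Finset.range B, ε (s + r)) (N : ℕ) :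
    ∑ k ∈ Finset.range N, u k ^ 2 ≤ B * D ^ 2 / β
      + (1 + 1 / β) * 4 * B ^ 2 / β * ∑ k ∈ Finset.range N, ε k ^ 2 := by
  have hsq : ∀ s, u (s + B) ^ 2 ≤ (1 - β) * u s ^ 2
      + (1 + 1 / β) * 4 * B * ∑ r ∈ Finset.range B, ε (s + r) ^ 2 := by
    intro s
    set q := ∑ r ∈ Finset.range B, ε (s + r) with hq
    have hq0 : 0 ≤ q := Finset.sum_nonneg fun r _ => hε _
    have hcs : q ^ 2 ≤ B * ∑ r ∈ Finset.range B, ε (s + r) ^ 2 := by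
      simpa using sq_sum_le_card_mul_sum_sq (s := Finset.range B) (f := fun r => ε (s + r))
    have h1 : u (s + B) ^ 2 ≤ ((1 - β) * u s + 2 * q) ^ 2 :=
      pow_le_pow_left₀ (hu _) (h s) 2
    -- Young's inequality with weight `β`: since (1 + β)(1 - β)² ≤ 1 - β, the square still
    -- contracts.
    have h2 : ((1 - β) * u s + 2 * q) ^ 2
        ≤ (1 + β) * ((1 - β) * u s) ^ 2 + (1 + 1 / β) * (2 * q) ^ 2 := by
      have h3 : 0 ≤ (1 / β) * (β * ((1 - β) * u s) - 2 * q) ^ 2 := by positivity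
      have h4 : (1 / β) * (β * ((1 - β) * u s) - 2 * q) ^ 2
          = β * ((1 - β) * u s) ^ 2 - 2 * ((1 - β) * u s) * (2 * q) + 1 / β * (2 * q) ^ 2 := by
        field_simp
        ring
      nlinarith
    have h5 : (1 + β) * ((1 - β) * u s) ^ 2 ≤ (1 - β) * u s ^ 2 := by
      have h6 : (1 + β) * (1 - β) ≤ 1 := by nlinarith
      calc (1 + β) * ((1 - β) * u s) ^ 2
          = ((1 + β) * (1 - β)) * ((1 - β) * u s ^ 2) := by ring
        _ ≤ 1 * ((1 - β) * u s ^ 2) :=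
            mul_le_mul_of_nonneg_right h6 (mul_nonneg (by linarith) (sq_nonneg _))
        _ = _ := one_mul _
    have h7 : (1 + 1 / β) * (2 * q) ^ 2
        ≤ (1 + 1 / β) * 4 * B * ∑ r ∈ Finset.range B, ε (s + r) ^ 2 := by
      have := mul_le_mul_of_nonneg_left hcs (show 0 ≤ (1 + 1 / β) * 4 by positivity)
      linarith
    linarith
  have hD : ∀ k, u k ^ 2 ≤ D ^ 2 := fun k => pow_le_pow_left₀ (hu k) (huD k) 2
  have hfirst : ∀ n, n ≤ B → ∑ k ∈ Finset.range n, u k ^ 2 ≤ B * D ^ 2 := fun n hn => by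
    calc ∑ k ∈ Finset.range n, u k ^ 2 ≤ ∑ k ∈ Finset.range n, D ^ 2 :=
          Finset.sum_le_sum fun k _ => hD k
      _ = n * D ^ 2 := by simp
      _ ≤ B * D ^ 2 := mul_le_mul_of_nonneg_right (by exact_mod_cast hn) (sq_nonneg _)
  have hmain : β * ∑ k ∈ Finset.range N, u k ^ 2 ≤ B * D ^ 2
      + (1 + 1 / β) * 4 * B ^ 2 * ∑ k ∈ Finset.range N, ε k ^ 2 := by
    have hE : 0 ≤ ∑ k ∈ Finset.range N, ε k ^ 2 := Finset.sum_nonneg fun k _ => sq_nonneg _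
    rcases le_total N B with hN | hN
    · have h1 : β * ∑ k ∈ Finset.range N, u k ^ 2 ≤ 1 * ∑ k ∈ Finset.range N, u k ^ 2 :=
        mul_le_mul_of_nonneg_right hβ1 (Finset.sum_nonneg fun k _ => sq_nonneg _)
      have h2 := hfirst N hN
      have h3 : 0 ≤ (1 + 1 / β) * 4 * B ^ 2 * ∑ k ∈ Finset.range N, ε k ^ 2 := by positivity
      linarith
    · obtain ⟨n, rfl⟩ := Nat.exists_eq_add_of_le hN
      have hsplit : ∑ k ∈ Finset.range (B + n), u k ^ 2
          = ∑ k ∈ Finset.range B, u k ^ 2 + ∑ k ∈ Finset.range n, u (k + B) ^ 2 := by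
        rw [Finset.sum_range_add]
        simp_rw [add_comm B]
      have hn : ∑ k ∈ Finset.range n, u k ^ 2 ≤ ∑ k ∈ Finset.range (B + n), u k ^ 2 :=
        Finset.sum_le_sum_of_subset_of_nonneg (Finset.range_mono (by omega))
          fun _ _ _ => sq_nonneg _
      have herr : ∑ k ∈ Finset.range n, ∑ r ∈ Finset.range B, ε (k + r) ^ 2
          ≤ B * ∑ k ∈ Finset.range (B + n), ε k ^ 2 := by
        rw [Finset.sum_comm]
        calc ∑ r ∈ Finset.range B, ∑ k ∈ Finset.range n, ε (k + r) ^ 2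
            ≤ ∑ r ∈ Finset.range B, ∑ k ∈ Finset.range (B + n), ε k ^ 2 := by
              refine Finset.sum_le_sum fun r hr => ?_
              have hr := Finset.mem_range.1 hr
              calc ∑ k ∈ Finset.range n, ε (k + r) ^ 2
                  ≤ ∑ k ∈ Finset.range (r + n), ε k ^ 2 := by
                    rw [Finset.sum_range_add]
                    simp_rw [add_comm r]
                    exact le_add_of_nonneg_left (Finset.sum_nonneg fun _ _ => sq_nonneg _)
                _ ≤ _ := Finset.sum_le_sum_of_subset_of_nonneg (Finset.range_mono (by omega))
                    fun _ _ _ => sq_nonneg _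
          _ = _ := by simp
      have hshift : ∑ k ∈ Finset.range n, u (k + B) ^ 2
          ≤ (1 - β) * ∑ k ∈ Finset.range n, u k ^ 2
            + (1 + 1 / β) * 4 * B * ∑ k ∈ Finset.range n, ∑ r ∈ Finset.range B, ε (k + r) ^ 2 := by
        rw [Finset.mul_sum, Finset.mul_sum, ← Finset.sum_add_distrib]
        exact Finset.sum_le_sum fun k _ => hsq k
      have h1 := hfirst B le_rfl
      have h2 := mul_le_mul_of_nonneg_left herr (show 0 ≤ (1 + 1 / β) * 4 * B by positivity)
      -- Enlarging the shifted sum to the full range lets its multiple by `1 - β` be absorbed on the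
      -- left, which leaves `β` times the full sum.
      have h3 := mul_le_mul_of_nonneg_left hn (sub_nonneg.2 hβ1)
      rw [hsplit] at h3 ⊢
      linarith
  rw [div_mul_eq_mul_div, ← add_div, le_div_iff₀ hβ0, mul_comm]
  exact hmain

/-! ### Convex geometry and the proximal step -/

/-- Points of the sets `X i` that are close to each other are close to a point of `⋂ i, X i`, at a
linear rate, as soon as this intersection has an interior point. -/
theorem exists_mem_iInter_norm_sub_le {m : ℕ} {E : Type*} [NormedAddCommGroup E]
    [NormedSpace ℝ E] {X : Fin m → Set E} (hX : ∀ i, Convex ℝ (X i))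
    (hint : (interior (⋂ i, X i)).Nonempty) {R : ℝ} (hR : ∀ i, ∀ x ∈ X i, ‖x‖ ≤ R) :
    ∃ K : ℝ, 0 ≤ K ∧ ∀ y : Fin m → E, (∀ i, y i ∈ X i) →
      ∃ w ∈ ⋂ i, X i, ∀ i, ‖y i - w‖ ≤ K * spread y := by
  obtain ⟨p, hp⟩ := hint
  obtain ⟨ρ, hρ, hball⟩ := Metric.nhds_basis_closedBall.mem_iff.1 (mem_interior_iff_mem_nhds.1 hp)
  have hpX := interior_subset hp
  rcases Nat.eq_zero_or_pos m with rfl | hm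
  · exact ⟨0, le_rfl, fun y _ => ⟨p, hpX, fun i => i.elim0⟩⟩
  let o : Fin m := ⟨0, hm⟩
  have hR0 : 0 ≤ R := (norm_nonneg p).trans (hR o p (Set.mem_iInter.1 hpX o))
  refine ⟨1 + 2 * R / ρ, by positivity, fun y hy => ?_⟩
  set δ := spread y with hδ
  have hδ0 : 0 ≤ δ := spread_nonneg y
  have hsum : 0 < δ + ρ := by linarith
  -- Pull `y o` towards the interior point `p`. For every `j` the same point is the combination,
  -- with the same weights, of `y j` and `p + (ρ / δ) • (y o - y j)`, and the latter lies in the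
  -- `ρ`-ball about `p`.
  refine ⟨(ρ / (δ + ρ)) • y o + (δ / (δ + ρ)) • p, Set.mem_iInter.2 fun j => ?_, fun i => ?_⟩
  · rcases hδ0.eq_or_lt with h0 | hpos
    · have hj : y o = y j := by
        have := norm_sub_le_spread y o j
        rw [← hδ, ← h0] at this
        exact sub_eq_zero.1 (norm_le_zero_iff.1 this)
      rw [← h0, hj]
      simpa [div_self hρ.ne'] using hy j
    · have hq : p + (ρ / δ) • (y o - y j) ∈ X j := by
        refine Set.mem_iInter.1 (hball ?_) j
        rw [mem_closedBall_iff_norm, add_sub_cancel_left, norm_smul,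
          Real.norm_of_nonneg (by positivity)]
        calc ρ / δ * ‖y o - y j‖ ≤ ρ / δ * δ :=
              mul_le_mul_of_nonneg_left (norm_sub_le_spread y o j) (by positivity)
          _ = ρ := div_mul_cancel₀ _ hpos.ne'
      have := hX j (hy j) hq (a := ρ / (δ + ρ)) (b := δ / (δ + ρ)) (by positivity)
        (by positivity) (by field_simp; ring)
      convert this using 1
      rw [smul_add, smul_smul, show δ / (δ + ρ) * (ρ / δ) = ρ / (δ + ρ) by field_simp, smul_sub]
      abel
  · have h1 : y i - ((ρ / (δ + ρ)) • y o + (δ / (δ + ρ)) • p)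
        = (y i - y o) + (δ / (δ + ρ)) • (y o - p) := by
      have : y o = (ρ / (δ + ρ)) • y o + (δ / (δ + ρ)) • y o := by
        rw [← add_smul, ← add_div, add_comm ρ, div_self hsum.ne', one_smul]
      rw [smul_sub]
      nth_rewrite 2 [this]
      abel
    have h2 : ‖y o - p‖ ≤ 2 * R := by
      have := norm_sub_le (y o) p
      have := hR o _ (hy o)
      have := hR o p (Set.mem_iInter.1 hpX o)
      linarith
    rw [h1]
    refine (norm_add_le _ _).trans ?_
    rw [norm_smul, Real.norm_of_nonneg (by positivity)]
    have h3 : δ / (δ + ρ) * ‖y o - p‖ ≤ δ / ρ * (2 * R) := by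
      gcongr
      linarith
    have h4 := norm_sub_le_spread y i o
    calc ‖y i - y o‖ + δ / (δ + ρ) * ‖y o - p‖ ≤ δ + δ / ρ * (2 * R) := add_le_add h4 h3
      _ = (1 + 2 * R / ρ) * δ := by ring

/-- On a ball, a finite convex function is Lipschitz and its subgradients are bounded. -/
theorem exists_lipschitz_const {n : ℕ} {f : EuclideanSpace ℝ (Fin n) → ℝ}
    (hf : ConvexOn ℝ Set.univ f) (R : ℝ) :
    ∃ L : ℝ, 0 ≤ L ∧ (∀ x y, ‖x‖ ≤ R → ‖y‖ ≤ R → |f x - f y| ≤ L * ‖x - y‖) ∧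
      ∀ x, ‖x‖ ≤ R → ∀ ξ ∈ subdifferential f x, ‖ξ‖ ≤ L := by
  have hcont : Continuous f := hf.locallyLipschitz.continuous
  -- The margins leave room for a unit step from the `R`-ball in the direction of a subgradient;
  -- such a step bounds its norm by the Lipschitz constant.
  have hbdd : Bornology.IsBounded (f '' Metric.ball 0 (R + 3)) :=
    (((isCompact_closedBall _ _).image hcont).isBounded).subset
      (Set.image_mono Metric.ball_subset_closedBall)
  obtain ⟨K, hK⟩ := (hf.subset (Set.subset_univ _)
    (convex_ball 0 (R + 3))).exists_lipschitzOnWith_of_isBounded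
      (show R + 2 < R + 3 by linarith) hbdd
  have hlip : ∀ x y, ‖x‖ < R + 2 → ‖y‖ < R + 2 → |f x - f y| ≤ K * ‖x - y‖ := fun x y hx hy => by
    simpa [Real.dist_eq, dist_eq_norm] using
      hK.dist_le_mul x (by simpa using hx) y (by simpa using hy)
  refine ⟨K, K.2, fun x y hx hy => hlip x y (by linarith) (by linarith), fun x hx ξ hξ => ?_⟩
  rcases eq_or_ne ξ 0 with rfl | h0
  · simp
  have hn : ‖ξ‖ ≠ 0 := norm_ne_zero_iff.2 h0
  have hu : ‖‖ξ‖⁻¹ • ξ‖ = 1 := by rw [norm_smul, norm_inv, norm_norm, inv_mul_cancel₀ hn]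
  have h1 := hξ (x + ‖ξ‖⁻¹ • ξ)
  have h2 := hlip (x + ‖ξ‖⁻¹ • ξ) x
    (by have := norm_add_le x (‖ξ‖⁻¹ • ξ); linarith) (by linarith)
  rw [add_sub_cancel_left, hu] at h2
  rw [add_sub_cancel_left, inner_smul_right, real_inner_self_eq_norm_sq, pow_two,
    inv_mul_cancel_left₀ hn] at h1
  have := le_abs_self (f (x + ‖ξ‖⁻¹ • ξ) - f x)
  linarith

theorem exists_uniform_lipschitz_const {n m : ℕ} {f : Fin m → EuclideanSpace ℝ (Fin n) → ℝ}
    (hf : ∀ i, ConvexOn ℝ Set.univ (f i)) (R : ℝ) :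
    ∃ L : ℝ, 0 ≤ L ∧ (∀ i x y, ‖x‖ ≤ R → ‖y‖ ≤ R → |f i x - f i y| ≤ L * ‖x - y‖) ∧
      ∀ i x, ‖x‖ ≤ R → ∀ ξ ∈ subdifferential (f i) x, ‖ξ‖ ≤ L := by
  choose L hL0 hL1 hL2 using fun i => exists_lipschitz_const (hf i) R
  have hle : ∀ i, L i ≤ ∑ i, L i := fun i =>
    Finset.single_le_sum (fun j _ => hL0 j) (Finset.mem_univ i)
  exact ⟨∑ i, L i, Finset.sum_nonneg fun i _ => hL0 i,
    fun i x y hx hy => (hL1 i x y hx hy).trans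
      (mul_le_mul_of_nonneg_right (hle i) (norm_nonneg _)),
    fun i x hx ξ hξ => (hL2 i x hx ξ hξ).trans (hle i)⟩

/-- First-order optimality of `p`: compare with `p + t • (y - p)`, divide by `t` and let `t` tend to
0. Expanding ‖z - y‖² around `p` turns this into the three-point inequality. -/
theorem prox_inequality {E : Type*} [NormedAddCommGroup E] [InnerProductSpace ℝ E] {X : Set E}
    (hX : Convex ℝ X) {c : ℝ} (hc : 0 < c) {d z p y : E} (hp : p ∈ X) (hy : y ∈ X)
    (hmin : IsMinOn (fun ξ => inner ℝ d ξ + 1 / (2 * c) * ‖z - ξ‖ ^ 2) X p) :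
    ‖p - z‖ ^ 2 + 2 * c * inner ℝ d (p - y) + ‖p - y‖ ^ 2 ≤ ‖z - y‖ ^ 2 := by
  have hvar : ∀ t : ℝ, 0 < t → t ≤ 1 →
      0 ≤ 2 * c * inner ℝ d (y - p) - 2 * inner ℝ (z - p) (y - p) + t * ‖y - p‖ ^ 2 := by
    intro t ht ht1
    have hmem : p + t • (y - p) ∈ X := hX.add_smul_sub_mem hp hy ⟨ht.le, ht1⟩
    have h1 : inner ℝ d p + 1 / (2 * c) * ‖z - p‖ ^ 2
        ≤ inner ℝ d (p + t • (y - p)) + 1 / (2 * c) * ‖z - (p + t • (y - p))‖ ^ 2 := hmin hmem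
    rw [← sub_sub, norm_sub_sq_real (z - p), inner_add_right, inner_smul_right, inner_smul_right,
      norm_smul, Real.norm_of_nonneg ht.le] at h1
    have h2 : 0 ≤ (2 * c) * (t * inner ℝ d (y - p)
        + 1 / (2 * c) * (-2 * (t * inner ℝ (z - p) (y - p)) + (t * ‖y - p‖) ^ 2)) :=
      mul_nonneg (by positivity) (by linarith)
    have h3 : (2 * c) * (t * inner ℝ d (y - p)
        + 1 / (2 * c) * (-2 * (t * inner ℝ (z - p) (y - p)) + (t * ‖y - p‖) ^ 2))
        = t * (2 * c * inner ℝ d (y - p) - 2 * inner ℝ (z - p) (y - p) + t * ‖y - p‖ ^ 2) := by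
      field_simp
      ring
    rw [h3] at h2
    exact nonneg_of_mul_nonneg_right h2 ht
  have hlim : Tendsto (fun t : ℝ => 2 * c * inner ℝ d (y - p) - 2 * inner ℝ (z - p) (y - p)
      + t * ‖y - p‖ ^ 2) (𝓝[>] 0)
      (𝓝 (2 * c * inner ℝ d (y - p) - 2 * inner ℝ (z - p) (y - p) + 0 * ‖y - p‖ ^ 2)) :=
    (Continuous.tendsto (by fun_prop) 0).mono_left nhdsWithin_le_nhds
  have h0 := ge_of_tendsto hlim (by
    filter_upwards [Ioc_mem_nhdsGT (zero_lt_one' ℝ)] with t ht using hvar t ht.1 ht.2)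
  have h4 : z - y = (z - p) - (y - p) := by abel
  rw [h4, norm_sub_sq_real (z - p), norm_sub_rev p z, norm_sub_rev p y,
    ← neg_sub y p, inner_neg_right]
  linarith

/-! ### Step sizes and running averages -/

theorem stepSize_pos {η : ℝ} (hη : 0 < η) (k : ℕ) : 0 < stepSize η k := by
  unfold stepSize
  positivity

theorem stepSum_pos {c : ℕ → ℝ} (hc : ∀ k, 0 < c k) {k : ℕ} (hk : 1 ≤ k) : 0 < stepSum c k :=
  Finset.sum_pos (fun r _ => hc r) ⟨1, by simpa using hk⟩

theorem mul_sqrt_le_stepSum {η : ℝ} (hη : 0 < η) (k : ℕ) :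
    η / 2 * √(k : ℝ) ≤ stepSum (stepSize η) k := by
  rcases Nat.eq_zero_or_pos k with rfl | hk
  · simp [stepSum]
  have hk1 : (1 : ℝ) ≤ k := by exact_mod_cast hk
  have hs : √((k : ℝ) + 1) ≤ 2 * √(k : ℝ) := by
    rw [show (2 : ℝ) = √4 by rw [show (4 : ℝ) = 2 ^ 2 by norm_num]; simp,
      ← Real.sqrt_mul (by norm_num)]
    exact Real.sqrt_le_sqrt (by linarith)
  have hpos : 0 < √((k : ℝ) + 1) := Real.sqrt_pos.2 (by linarith)
  -- Each of the `k` terms is at least the last one.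
  have h1 : k * (η / √((k : ℝ) + 1)) ≤ stepSum (stepSize η) k := by
    have : ∀ r ∈ Finset.Icc 1 k, η / √((k : ℝ) + 1) ≤ stepSize η r := fun r hr => by
      have : (r : ℝ) ≤ k := by exact_mod_cast (Finset.mem_Icc.1 hr).2
      unfold stepSize
      gcongr
    simpa [stepSum] using Finset.card_nsmul_le_sum _ _ _ this
  refine le_trans ?_ h1
  rw [mul_div_assoc', le_div_iff₀ hpos]
  have hkk : √(k : ℝ) * √(k : ℝ) = k := Real.mul_self_sqrt (by linarith)
  calc η / 2 * √(k : ℝ) * √((k : ℝ) + 1) ≤ η / 2 * √(k : ℝ) * (2 * √(k : ℝ)) := by gcongr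
    _ = η * (√(k : ℝ) * √(k : ℝ)) := by ring
    _ = k * η := by rw [hkk, mul_comm]

theorem sum_stepSize_sq_le (η : ℝ) {k : ℕ} (hk : 1 ≤ k) :
    ∑ r ∈ Finset.range (k + 1), stepSize η r ^ 2 ≤ 2 * η ^ 2 * (1 + Real.log k) := by
  have hk1 : (1 : ℝ) ≤ k := by exact_mod_cast hk
  have h1 : ∑ r ∈ Finset.range (k + 1), stepSize η r ^ 2 = η ^ 2 * (harmonic (k + 1) : ℝ) := by
    rw [harmonic]
    push_cast
    rw [Finset.mul_sum]
    refine Finset.sum_congr rfl fun r _ => ?_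
    rw [stepSize, div_pow, Real.sq_sqrt (by positivity), div_eq_mul_inv]
  have h2 : (harmonic (k + 1) : ℝ) ≤ 1 + Real.log ((k + 1 : ℕ) : ℝ) := harmonic_le_one_add_log _
  have h3 : Real.log ((k + 1 : ℕ) : ℝ) ≤ 1 + Real.log k := by
    calc Real.log ((k + 1 : ℕ) : ℝ) ≤ Real.log (2 * k) :=
          Real.log_le_log (by positivity) (by push_cast; linarith)
      _ = Real.log 2 + Real.log k := Real.log_mul (by norm_num) (by linarith)
      _ ≤ _ := by have := Real.log_two_lt_d9; linarith
  have h4 : 0 ≤ Real.log k := Real.log_nonneg hk1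
  rw [h1, mul_comm 2, mul_assoc]
  exact mul_le_mul_of_nonneg_left (by linarith) (sq_nonneg η)

theorem runningAverage_eq {n : ℕ} {c : ℕ → ℝ} (hc : ∀ k, 0 < c k)
    (y : ℕ → EuclideanSpace ℝ (Fin n)) {k : ℕ} (hk : 1 ≤ k) :
    runningAverage c y k = ∑ r ∈ Finset.Icc 1 k, ((stepSum c k)⁻¹ * c r) • y r := by
  -- As `stepSum c 0 = 0`, the initial value `y 0` carries no weight from `k = 1` on.
  have key : ∀ k, stepSum c k • runningAverage c y k = ∑ r ∈ Finset.Icc 1 k, c r • y r := by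
    intro k
    induction k with
    | zero => simp [stepSum]
    | succ k ih =>
      rw [runningAverage, smul_smul, mul_inv_cancel₀ (stepSum_pos hc (by omega)).ne', one_smul,
        ih, Finset.sum_Icc_succ_top (by omega), add_comm]
  simp_rw [mul_smul]
  rw [← Finset.smul_sum, ← key, smul_smul, inv_mul_cancel₀ (stepSum_pos hc hk).ne', one_smul]

theorem sum_weights_eq_one {c : ℕ → ℝ} (hc : ∀ k, 0 < c k) {k : ℕ} (hk : 1 ≤ k) :
    ∑ r ∈ Finset.Icc 1 k, (stepSum c k)⁻¹ * c r = 1 := by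
  rw [← Finset.mul_sum, ← stepSum, inv_mul_cancel₀ (stepSum_pos hc hk).ne']

theorem weight_nonneg {c : ℕ → ℝ} (hc : ∀ k, 0 < c k) {k : ℕ} (hk : 1 ≤ k) (r : ℕ) :
    0 ≤ (stepSum c k)⁻¹ * c r :=
  mul_nonneg (inv_nonneg.2 (stepSum_pos hc hk).le) (hc r).le

theorem runningAverage_mem {n : ℕ} {c : ℕ → ℝ} (hc : ∀ k, 0 < c k)
    {y : ℕ → EuclideanSpace ℝ (Fin n)} {C : Set (EuclideanSpace ℝ (Fin n))} (hC : Convex ℝ C)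
    (hy : ∀ k, y k ∈ C) (k : ℕ) : runningAverage c y k ∈ C := by
  rcases Nat.eq_zero_or_pos k with rfl | hk
  · exact hy 0
  rw [runningAverage_eq hc y hk]
  exact hC.sum_mem (fun r _ => weight_nonneg hc hk r) (sum_weights_eq_one hc hk) fun r _ => hy r

theorem norm_runningAverage_sub_le {n : ℕ} {c : ℕ → ℝ} (hc : ∀ k, 0 < c k)
    (y w : ℕ → EuclideanSpace ℝ (Fin n)) {k : ℕ} (hk : 1 ≤ k) :
    ‖runningAverage c y k - runningAverage c w k‖
      ≤ (stepSum c k)⁻¹ * ∑ r ∈ Finset.Icc 1 k, c r * ‖y r - w r‖ := by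
  rw [runningAverage_eq hc y hk, runningAverage_eq hc w hk, ← Finset.sum_sub_distrib,
    Finset.mul_sum]
  refine (norm_sum_le _ _).trans (Finset.sum_le_sum fun r _ => ?_)
  rw [← smul_sub, norm_smul, Real.norm_of_nonneg (weight_nonneg hc hk r), mul_assoc]

theorem map_runningAverage_sub_le {n : ℕ} {c : ℕ → ℝ} (hc : ∀ k, 0 < c k)
    {F : EuclideanSpace ℝ (Fin n) → ℝ} (hF : ConvexOn ℝ Set.univ F)
    (w : ℕ → EuclideanSpace ℝ (Fin n)) (a : ℝ) {k : ℕ} (hk : 1 ≤ k) :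
    F (runningAverage c w k) - a
      ≤ (stepSum c k)⁻¹ * ∑ r ∈ Finset.Icc 1 k, c r * (F (w r) - a) := by
  rw [runningAverage_eq hc w hk]
  have h := hF.map_sum_le (t := Finset.Icc 1 k) (w := fun r => (stepSum c k)⁻¹ * c r) (p := w)
    (fun r _ => weight_nonneg hc hk r) (sum_weights_eq_one hc hk) (fun r _ => Set.mem_univ _)
  have h2 : (stepSum c k)⁻¹ * ∑ r ∈ Finset.Icc 1 k, c r * (F (w r) - a)
      = ∑ r ∈ Finset.Icc 1 k, ((stepSum c k)⁻¹ * c r) • F (w r)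
        - (∑ r ∈ Finset.Icc 1 k, (stepSum c k)⁻¹ * c r) * a := by
    rw [Finset.mul_sum, Finset.sum_mul, ← Finset.sum_sub_distrib]
    refine Finset.sum_congr rfl fun r _ => ?_
    rw [smul_eq_mul]
    ring
  rw [h2, sum_weights_eq_one hc hk, one_mul]
  exact sub_le_sub_right h a

theorem sum_Icc_le_sum_range {u : ℕ → ℝ} (hu : ∀ k, 0 ≤ u k) (k : ℕ) :
    ∑ r ∈ Finset.Icc 1 k, u r ≤ ∑ r ∈ Finset.range (k + 1), u r :=
  Finset.sum_le_sum_of_subset_of_nonneg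
    (fun r hr => Finset.mem_range.2 (by have := (Finset.mem_Icc.1 hr).2; omega))
    fun r _ _ => hu r

theorem convexOn_objective {n m : ℕ} {f : Fin m → EuclideanSpace ℝ (Fin n) → ℝ}
    (hf : ∀ i, ConvexOn ℝ Set.univ (f i)) : ConvexOn ℝ Set.univ (objective f) := by
  refine ⟨convex_univ, fun x hx y hy a b ha hb hab => ?_⟩
  simp only [objective, smul_eq_mul, Finset.mul_sum]
  rw [← Finset.sum_add_distrib]
  exact Finset.sum_le_sum fun i _ => by simpa using (hf i).2 hx hy ha hb hab

/-! ### Descent and summation -/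

/-- Summing a perturbed descent inequality by means of Young's inequality. -/
theorem exists_bound_of_descent (C C₁ C₂ D : ℝ) (hC₁ : 0 ≤ C₁) (hC₂ : 0 ≤ C₂)
    (hD : 0 ≤ D) :
    ∃ M : ℝ, 0 ≤ M ∧ ∀ c ε δ h V : ℕ → ℝ, (∀ k, 0 ≤ c k * h k) → (∀ k, 0 ≤ V k) → V 0 ≤ D →
      (∀ N, ∑ k ∈ Finset.range N, δ k ^ 2 ≤ C₁ + C₂ * ∑ k ∈ Finset.range N, ε k ^ 2) →
      (∀ k, ε k ^ 2 + 2 * (c k * h k) + V (k + 1) ≤ V k + 2 * c k * (C * (δ k + ε k))) →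
      ∀ N, ∑ k ∈ Finset.range N, c k * h k ≤ M * (1 + ∑ k ∈ Finset.range N, c k ^ 2) ∧
        ∑ k ∈ Finset.range N, c k * δ k ≤ M * (1 + ∑ k ∈ Finset.range N, c k ^ 2) := by
  -- This Young weight makes `C₂ / a ≤ 1 / 4`. The δ-term then costs a quarter of ∑ ε², the ε-term
  -- another quarter, and half of ∑ ε² survives to bound ∑ δ².
  set a := 4 * (C₂ + 1) with ha
  have ha0 : 0 < a := by positivity
  set G := D + C₁ + (a + 4) * C ^ 2 with hG
  have hG0 : 0 ≤ G := by positivity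
  refine ⟨G + 1 + C₁ + C₂ * G, by positivity, fun c ε δ h V hch hV hV0 hδ hstep N => ?_⟩
  set P := ∑ k ∈ Finset.range N, c k ^ 2 with hP
  set Q := ∑ k ∈ Finset.range N, ε k ^ 2 with hQ
  set H := ∑ k ∈ Finset.range N, c k * h k with hH
  have hP0 : 0 ≤ P := Finset.sum_nonneg fun _ _ => sq_nonneg _
  have hQ0 : 0 ≤ Q := Finset.sum_nonneg fun _ _ => sq_nonneg _
  have hH0 : 0 ≤ H := Finset.sum_nonneg fun k _ => hch k
  have hyoung : ∀ k, 3 / 4 * ε k ^ 2 + 2 * (c k * h k)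
      ≤ (V k - V (k + 1)) + (a + 4) * C ^ 2 * c k ^ 2 + 1 / a * δ k ^ 2 := by
    intro k
    have h1 : 0 ≤ 1 / a * (a * (C * c k) - δ k) ^ 2 := by positivity
    have h2 : 1 / a * (a * (C * c k) - δ k) ^ 2
        = a * C ^ 2 * c k ^ 2 - 2 * c k * (C * δ k) + 1 / a * δ k ^ 2 := by
      field_simp
      ring
    have h3 := sq_nonneg (2 * (C * c k) - 1 / 2 * ε k)
    have h4 := hstep k
    linarith
  have hsum : 3 / 4 * Q + 2 * H ≤ (V 0 - V N) + (a + 4) * C ^ 2 * P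
      + 1 / a * ∑ k ∈ Finset.range N, δ k ^ 2 := by
    have h1 := Finset.sum_le_sum fun k (_ : k ∈ Finset.range N) => hyoung k
    simp only [Finset.sum_add_distrib, ← Finset.mul_sum, Finset.sum_range_sub'] at h1
    exact h1
  have hδ' : 1 / a * ∑ k ∈ Finset.range N, δ k ^ 2 ≤ C₁ + 1 / 4 * Q := by
    have h1 := mul_le_mul_of_nonneg_left (hδ N) (show 0 ≤ 1 / a by positivity)
    have h2 : 1 / a * C₁ ≤ C₁ := by
      have : 1 / a ≤ 1 := by rw [div_le_one ha0]; linarith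
      nlinarith
    have h3 : 1 / a * C₂ ≤ 1 / 4 := by
      rw [div_mul_eq_mul_div, div_le_iff₀ ha0]
      linarith
    have h4 := mul_le_mul_of_nonneg_right h3 hQ0
    linarith
  have hGP : 1 / 2 * Q + 2 * H ≤ G * (1 + P) := by
    have := hV N
    have : 0 ≤ (D + C₁) * P := by positivity
    have : 0 ≤ (a + 4) * C ^ 2 := by positivity
    rw [hG]
    linarith
  have hR : 0 ≤ 1 + P := by linarith
  have hGP0 : 0 ≤ G * (1 + P) := by positivity
  constructor
  · have : 0 ≤ (1 + C₁ + C₂ * G) * (1 + P) := by positivity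
    linarith
  · have h1 : 2 * ∑ k ∈ Finset.range N, c k * δ k ≤ P + ∑ k ∈ Finset.range N, δ k ^ 2 := by
      rw [hP, Finset.mul_sum, ← Finset.sum_add_distrib]
      exact Finset.sum_le_sum fun k _ => by have := sq_nonneg (c k - δ k); linarith
    have h2 := hδ N
    have h3 : C₂ * Q ≤ C₂ * (2 * (G * (1 + P))) :=
      mul_le_mul_of_nonneg_left (by linarith) hC₂
    have h4 : 0 ≤ C₁ * P := by positivity
    linarith

theorem average_mem {m : ℕ} {E : Type*} [AddCommGroup E] [Module ℝ E]
    {P : Matrix (Fin m) (Fin m) ℝ} (hP : P ∈ doublyStochastic ℝ (Fin m)) {C : Set E}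
    (hC : Convex ℝ C) {y : Fin m → E} (hy : ∀ j, y j ∈ C) (i : Fin m) :
    ∑ j, P j i • y j ∈ C :=
  hC.sum_mem (fun _ _ => nonneg_of_mem_doublyStochastic hP) (sum_col_of_mem_doublyStochastic hP i)
    fun j _ => hy j

theorem norm_average_sub_le {m : ℕ} {E : Type*} [NormedAddCommGroup E] [NormedSpace ℝ E]
    {P : Matrix (Fin m) (Fin m) ℝ} (hP : P ∈ doublyStochastic ℝ (Fin m)) {y : Fin m → E} {w : E}
    {b : ℝ} (hy : ∀ j, ‖y j - w‖ ≤ b) (i : Fin m) : ‖∑ j, P j i • y j - w‖ ≤ b := by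
  have := average_mem hP (convex_closedBall w b) (y := y)
    (fun j => mem_closedBall_iff_norm.2 (hy j)) i
  exact mem_closedBall_iff_norm.1 this

/-- Jensen uses the column sums, and summing over `i` uses the row sums: double stochasticity is
needed in full. -/
theorem sum_norm_average_sub_sq_le {m : ℕ} {E : Type*} [NormedAddCommGroup E] [NormedSpace ℝ E]
    {P : Matrix (Fin m) (Fin m) ℝ} (hP : P ∈ doublyStochastic ℝ (Fin m)) (y : Fin m → E) (w : E) :
    ∑ i, ‖∑ j, P j i • y j - w‖ ^ 2 ≤ ∑ j, ‖y j - w‖ ^ 2 := by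
  have hconv : ConvexOn ℝ Set.univ fun v : E => ‖v‖ ^ 2 :=
    (convexOn_norm convex_univ).pow (fun _ _ => norm_nonneg _) 2
  calc ∑ i, ‖∑ j, P j i • y j - w‖ ^ 2 ≤ ∑ i, ∑ j, P j i * ‖y j - w‖ ^ 2 := by
        refine Finset.sum_le_sum fun i _ => ?_
        have h1 : ∑ j, P j i • y j - w = ∑ j, P j i • (y j - w) := by
          simp_rw [smul_sub, Finset.sum_sub_distrib, ← Finset.sum_smul,
            sum_col_of_mem_doublyStochastic hP, one_smul]
        rw [h1]
        simpa using hconv.map_sum_le (t := Finset.univ) (w := fun j => P j i)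
          (p := fun j => y j - w) (fun _ _ => nonneg_of_mem_doublyStochastic hP)
          (sum_col_of_mem_doublyStochastic hP i) (fun _ _ => Set.mem_univ _)
    _ = ∑ j, ‖y j - w‖ ^ 2 := by
        rw [Finset.sum_comm]
        simp_rw [← Finset.sum_mul, sum_row_of_mem_doublyStochastic hP, one_mul]

/-- The root of the sum of the squared distances between the averages and the updates. -/
noncomputable def updateError {n m : ℕ} (x z : ℕ → Fin m → EuclideanSpace ℝ (Fin n)) (k : ℕ) : ℝ :=
  √(∑ i, ‖x (k + 1) i - z k i‖ ^ 2)

theorem updateError_sq {n m : ℕ} (x z : ℕ → Fin m → EuclideanSpace ℝ (Fin n)) (k : ℕ) :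
    updateError x z k ^ 2 = ∑ i, ‖x (k + 1) i - z k i‖ ^ 2 :=
  Real.sq_sqrt (Finset.sum_nonneg fun _ _ => sq_nonneg _)

theorem norm_sub_le_updateError {n m : ℕ} (x z : ℕ → Fin m → EuclideanSpace ℝ (Fin n)) (k : ℕ)
    (i : Fin m) : ‖x (k + 1) i - z k i‖ ≤ updateError x z k :=
  Real.le_sqrt_of_sq_le (Finset.single_le_sum (f := fun i => ‖x (k + 1) i - z k i‖ ^ 2)
    (fun _ _ => sq_nonneg _) (Finset.mem_univ i))

theorem IsAlgorithmRun.mem {n m : ℕ} {f : Fin m → EuclideanSpace ℝ (Fin n) → ℝ}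
    {X : Fin m → Set (EuclideanSpace ℝ (Fin n))} {A : ℕ → Matrix (Fin m) (Fin m) ℝ} {c : ℕ → ℝ}
    {x z g d : ℕ → Fin m → EuclideanSpace ℝ (Fin n)} (h : IsAlgorithmRun f X A c x z g d)
    (k : ℕ) (i : Fin m) : x k i ∈ X i := by
  cases k with
  | zero => exact h.init i
  | succ k => exact h.update_mem k i

/-- One step of the algorithm decreases the sum of the squared distances to a feasible point. -/
theorem IsAlgorithmRun.descent {n m : ℕ} {f : Fin m → EuclideanSpace ℝ (Fin n) → ℝ}
    {X : Fin m → Set (EuclideanSpace ℝ (Fin n))} {A : ℕ → Matrix (Fin m) (Fin m) ℝ} {c : ℕ → ℝ}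
    {x z g d : ℕ → Fin m → EuclideanSpace ℝ (Fin n)} (h : IsAlgorithmRun f X A c x z g d)
    (hA : ∀ k, A k ∈ doublyStochastic ℝ (Fin m)) (hc : ∀ k, 0 < c k)
    (hX : ∀ i, Convex ℝ (X i)) {R L : ℝ} (hR : ∀ i, ∀ x ∈ X i, ‖x‖ ≤ R) (hL : 0 ≤ L)
    (hlip : ∀ i x y, ‖x‖ ≤ R → ‖y‖ ≤ R → |f i x - f i y| ≤ L * ‖x - y‖)
    (hsub : ∀ i x, ‖x‖ ≤ R → ∀ ξ ∈ subdifferential (f i) x, ‖ξ‖ ≤ L)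
    {w p : EuclideanSpace ℝ (Fin n)} (hw : w ∈ ⋂ i, X i) (hp : p ∈ ⋂ i, X i) {b : ℝ} (k : ℕ)
    (hb : ∀ i, ‖x k i - w‖ ≤ b) :
    updateError x z k ^ 2 + 2 * (c k * (objective f w - objective f p))
        + ∑ i, ‖x (k + 1) i - p‖ ^ 2
      ≤ ∑ i, ‖x k i - p‖ ^ 2 + 2 * c k * (m * L * (3 * b + updateError x z k)) := by
  have hwX := Set.mem_iInter.1 hw
  have hpX := Set.mem_iInter.1 hp
  have hz : ∀ i, ‖z k i‖ ≤ R := fun i => by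
    rw [h.average]
    simpa using norm_average_sub_le (hA k) (y := x k) (w := 0)
      (fun j => by simpa using hR j _ (h.mem k j)) i
  have hzw : ∀ i, ‖z k i - w‖ ≤ b := fun i => by
    rw [h.average]
    exact norm_average_sub_le (hA k) hb i
  have hg : ∀ i, ‖g k i‖ ≤ L := fun i => hsub i _ (hz i) _ (h.subgradient k i)
  have hd : ∀ i, ‖d k i‖ ≤ L := fun i => by
    rw [h.average_subgradient]
    simpa using norm_average_sub_le (hA k) (y := g k) (w := 0) (by simpa using hg) i
  have hprox : updateError x z k ^ 2 + ∑ i, 2 * c k * inner ℝ (d k i) (x (k + 1) i - p)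
      + ∑ i, ‖x (k + 1) i - p‖ ^ 2 ≤ ∑ i, ‖x k i - p‖ ^ 2 := by
    rw [updateError_sq, ← Finset.sum_add_distrib, ← Finset.sum_add_distrib]
    calc _ ≤ ∑ i, ‖z k i - p‖ ^ 2 := Finset.sum_le_sum fun i _ =>
          prox_inequality (hX i) (hc k) (h.update_mem k i) (hpX i) (h.update_argmin k i)
      _ ≤ _ := by
          simp_rw [h.average]
          exact sum_norm_average_sub_sq_le (hA k) (x k) p
  -- Row sums equal to one: against the fixed vector `w - p` the averaged subgradients may be
  -- replaced by the local ones, to which convexity of `f i` applies.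
  have hsumd : ∑ i, d k i = ∑ j, g k j := by
    simp_rw [h.average_subgradient]
    rw [Finset.sum_comm]
    simp_rw [← Finset.sum_smul, sum_row_of_mem_doublyStochastic (hA k), one_smul]
  have hsplit : ∑ i, inner ℝ (d k i) (x (k + 1) i - p)
      = ∑ i, (inner ℝ (d k i) (x (k + 1) i - w) + inner ℝ (g k i) (w - p)) := by
    have h1 : ∑ i, inner ℝ (d k i) (w - p) = ∑ i, inner ℝ (g k i) (w - p) := by
      rw [← sum_inner, hsumd, sum_inner]
    rw [Finset.sum_add_distrib, ← h1, ← Finset.sum_add_distrib]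
    refine Finset.sum_congr rfl fun i _ => ?_
    rw [← inner_add_right, sub_add_sub_cancel]
  -- The three `b` come from replacing `z k i` by `w` in the `d`-term, in the `g`-term and inside `f
  -- i`.
  have hterm : ∀ i, f i w - f i p - L * (3 * b + updateError x z k)
      ≤ inner ℝ (d k i) (x (k + 1) i - w) + inner ℝ (g k i) (w - p) := by
    intro i
    have h1 : -(L * (updateError x z k + b)) ≤ inner ℝ (d k i) (x (k + 1) i - w) := by
      have h2 : ‖x (k + 1) i - w‖ ≤ updateError x z k + b := by
        have := norm_add_le (x (k + 1) i - z k i) (z k i - w)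
        rw [sub_add_sub_cancel] at this
        have := norm_sub_le_updateError x z k i
        have := hzw i
        linarith
      exact (abs_le.1 ((abs_real_inner_le_norm _ _).trans
        (mul_le_mul (hd i) h2 (norm_nonneg _) hL))).1
    have h3 : -(L * b) ≤ inner ℝ (g k i) (w - z k i) :=
      (abs_le.1 ((abs_real_inner_le_norm _ _).trans
        (mul_le_mul (hg i) (by rw [norm_sub_rev]; exact hzw i) (norm_nonneg _) hL))).1
    have h4 := h.subgradient k i p
    have h5 : inner ℝ (g k i) (w - p) = inner ℝ (g k i) (w - z k i)
        - inner ℝ (g k i) (p - z k i) := by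
      rw [← inner_sub_right, sub_sub_sub_cancel_right]
    have h6 := (abs_le.1 (hlip i (z k i) w (hz i) (hR i w (hwX i)))).1
    have h7 := mul_le_mul_of_nonneg_left (hzw i) hL
    rw [h5]
    linarith
  have hsum : objective f w - objective f p - m * L * (3 * b + updateError x z k)
      ≤ ∑ i, inner ℝ (d k i) (x (k + 1) i - p) := by
    rw [hsplit]
    refine le_trans (le_of_eq ?_) (Finset.sum_le_sum fun i _ => hterm i)
    simp only [objective, Finset.sum_sub_distrib, Finset.sum_const, Finset.card_univ,
      Fintype.card_fin, nsmul_eq_mul]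
    ring
  have hmul := mul_le_mul_of_nonneg_left hsum (show 0 ≤ 2 * c k from by have := hc k; linarith)
  rw [← Finset.mul_sum] at hprox
  linarith

theorem exists_norm_le_of_mem {n m : ℕ} {X : Fin m → Set (EuclideanSpace ℝ (Fin n))}
    (hX : ∀ i, IsCompact (X i)) : ∃ R : ℝ, 0 ≤ R ∧ ∀ i, ∀ x ∈ X i, ‖x‖ ≤ R := by
  obtain ⟨R, hR⟩ := (isCompact_iUnion hX).isBounded.exists_norm_le
  exact ⟨max R 0, le_max_right _ _, fun i x hx =>
    (hR x (Set.mem_iUnion.2 ⟨i, hx⟩)).trans (le_max_left _ _)⟩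

/-! ### Feasible shadow sequences and their rates -/

/-- Every run is shadowed by a feasible sequence `w` along which the weighted sums of the
optimality gap and of the distance to the run are `O (1 + ∑ k, c k ^ 2)`, uniformly in the run. -/
theorem exists_shadowing_bound {n m : ℕ} {f : Fin m → EuclideanSpace ℝ (Fin n) → ℝ}
    {X : Fin m → Set (EuclideanSpace ℝ (Fin n))} (hfX : ConvexCompactProblem f X)
    {θ : ℝ} (hθ : θ ∈ Set.Ioo (0 : ℝ) 1) (T : ℕ) :
    ∃ M : ℝ, 0 ≤ M ∧ ∀ (A : ℕ → Matrix (Fin m) (Fin m) ℝ) (c : ℕ → ℝ)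
      (x z g d : ℕ → Fin m → EuclideanSpace ℝ (Fin n)), NetworkAssumptions A θ T →
      (∀ k, 0 < c k) → IsAlgorithmRun f X A c x z g d →
      ∃ w : ℕ → EuclideanSpace ℝ (Fin n), (∀ k, w k ∈ ⋂ i, X i) ∧
        ∀ p, IsOptimiser f X p → ∀ N,
          ∑ k ∈ Finset.range N, c k * (objective f (w k) - objective f p)
              ≤ M * (1 + ∑ k ∈ Finset.range N, c k ^ 2) ∧
          ∀ i, ∑ k ∈ Finset.range N, c k * ‖x k i - w k‖
              ≤ M * (1 + ∑ k ∈ Finset.range N, c k ^ 2) := by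
  obtain ⟨R, hR0, hR⟩ := exists_norm_le_of_mem hfX.compact_constraint
  obtain ⟨L, hL, hlip, hsub⟩ := exists_uniform_lipschitz_const hfX.convex_objective R
  obtain ⟨K, hK, hnear⟩ := exists_mem_iInter_norm_sub_le hfX.convex_constraint
    hfX.interior_nonempty hR
  set β := θ ^ (m * T) with hβ
  have hβ0 : 0 < β := pow_pos hθ.1 _
  have hβ1 : β ≤ 1 := pow_le_one₀ hθ.1.le hθ.2.le
  obtain ⟨M, hM, hbound⟩ := exists_bound_of_descent (m * L * (1 + 3 * K))
    ((m * T : ℕ) * (2 * R) ^ 2 / β) ((1 + 1 / β) * 4 * (m * T : ℕ) ^ 2 / β) (m * (2 * R) ^ 2)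
    (by positivity) (by positivity) (by positivity)
  refine ⟨(1 + K) * M, by positivity, fun A c x z g d hA hc hrun => ?_⟩
  choose w hw hxw using fun k => hnear (x k) (hrun.mem k)
  refine ⟨w, hw, fun p hp N => ?_⟩
  have hdist : ∀ k i q, ‖q‖ ≤ R → ‖x k i - q‖ ≤ 2 * R := fun k i q hq => by
    have := norm_sub_le (x k i) q
    have := hR i _ (hrun.mem k i)
    linarith
  obtain ⟨h1, h2⟩ := hbound c (updateError x z) (fun k => spread (x k))
    (fun k => objective f (w k) - objective f p) (fun k => ∑ i, ‖x k i - p‖ ^ 2)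
    (fun k => mul_nonneg (hc k).le (sub_nonneg.2 (hp.2 _ (hw k))))
    (fun k => Finset.sum_nonneg fun _ _ => sq_nonneg _)
    (by
      calc ∑ i, ‖x 0 i - p‖ ^ 2 ≤ ∑ i : Fin m, (2 * R) ^ 2 :=
            Finset.sum_le_sum fun i _ => pow_le_pow_left₀ (norm_nonneg _)
              (hdist 0 i p (hR i p (Set.mem_iInter.1 hp.1 i))) 2
        _ = m * (2 * R) ^ 2 := by simp)
    (sum_sq_le_of_window_contraction hβ0 hβ1 (fun k => spread_nonneg _)
      (fun k => spread_le (by positivity) fun i j => hdist k i _ (hR j _ (hrun.mem k j)))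
      (fun k => Real.sqrt_nonneg _)
      (spread_add_le hA hθ (fun k => Real.sqrt_nonneg _) fun k i => by
        rw [← hrun.average]
        exact norm_sub_le_updateError x z k i))
    (fun k => by
      refine (hrun.descent hA.doubly_stochastic hc hfX.convex_constraint hR hL hlip hsub (hw k)
        hp.1 k (hxw k)).trans ?_
      have := (hc k).le
      have hε : 0 ≤ updateError x z k := Real.sqrt_nonneg _
      have hδ := spread_nonneg (x k)
      have : 3 * (K * spread (x k)) + updateError x z k
          ≤ (1 + 3 * K) * (spread (x k) + updateError x z k) := by
        have := mul_nonneg hK hε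
        linarith
      rw [mul_assoc (m * L : ℝ)]
      gcongr) N
  have hP : 0 ≤ 1 + ∑ k ∈ Finset.range N, c k ^ 2 :=
    add_nonneg zero_le_one (Finset.sum_nonneg fun _ _ => sq_nonneg _)
  have hMP : 0 ≤ M * (1 + ∑ k ∈ Finset.range N, c k ^ 2) := mul_nonneg hM hP
  have hKMP := mul_nonneg hK hMP
  refine ⟨by linarith, fun i => ?_⟩
  calc ∑ k ∈ Finset.range N, c k * ‖x k i - w k‖
      ≤ ∑ k ∈ Finset.range N, K * (c k * spread (x k)) := Finset.sum_le_sum fun k _ => by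
        have := mul_le_mul_of_nonneg_left (hxw k i) (hc k).le
        linarith
    _ ≤ _ := by
        rw [← Finset.mul_sum]
        have := mul_le_mul_of_nonneg_left h2 hK
        linarith

/-- The shadowing estimates are stated relative to an optimiser, so agreement of the agents needs
one to exist. The index `i` supplies compactness, as an empty intersection of sets would be the
whole space. -/
theorem exists_isOptimiser {n m : ℕ} {f : Fin m → EuclideanSpace ℝ (Fin n) → ℝ}
    {X : Fin m → Set (EuclideanSpace ℝ (Fin n))} (hfX : ConvexCompactProblem f X) (i : Fin m) :
    ∃ p, IsOptimiser f X p := by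
  have hclosed : IsClosed (⋂ j, X j) :=
    isClosed_iInter fun j => (hfX.compact_constraint j).isClosed
  have hcomp : IsCompact (⋂ j, X j) :=
    (hfX.compact_constraint i).of_isClosed_subset hclosed (Set.iInter_subset _ _)
  have hcont : Continuous (objective f) :=
    (convexOn_objective hfX.convex_objective).locallyLipschitz.continuous
  obtain ⟨p, hp, hmin⟩ := hcomp.exists_isMinOn
    (hfX.interior_nonempty.mono interior_subset) hcont.continuousOn
  exact ⟨p, hp, fun x hx => hmin hx⟩

/-- The running averages of a run are shadowed by a feasible sequence `v` at rate
`(1 + log k) / √k`, uniformly in the run. -/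
theorem exists_runningAverage_bound {n m : ℕ} {f : Fin m → EuclideanSpace ℝ (Fin n) → ℝ}
    {X : Fin m → Set (EuclideanSpace ℝ (Fin n))} (hfX : ConvexCompactProblem f X)
    {η : ℝ} (hη : 0 < η) {θ : ℝ} (hθ : θ ∈ Set.Ioo (0 : ℝ) 1) (T : ℕ) :
    ∃ M : ℝ, 0 ≤ M ∧ ∀ (A : ℕ → Matrix (Fin m) (Fin m) ℝ)
      (x z g d : ℕ → Fin m → EuclideanSpace ℝ (Fin n)), NetworkAssumptions A θ T →
      IsAlgorithmRun f X A (stepSize η) x z g d →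
      ∃ v : ℕ → EuclideanSpace ℝ (Fin n), (∀ k, v k ∈ ⋂ i, X i) ∧
        ∀ p, IsOptimiser f X p → ∀ k : ℕ, 1 ≤ k →
          objective f (v k) - objective f p ≤ M * ((1 + Real.log k) / √(k : ℝ)) ∧
          ∀ i, ‖runningAverage (stepSize η) (fun k => x k i) k - v k‖
              ≤ M * ((1 + Real.log k) / √(k : ℝ)) := by
  obtain ⟨M, hM, hbound⟩ := exists_shadowing_bound hfX hθ T
  refine ⟨2 / η * (M * (1 + 2 * η ^ 2)), by positivity, fun A x z g d hA hrun => ?_⟩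
  have hc := stepSize_pos hη
  obtain ⟨w, hw, hw'⟩ := hbound A (stepSize η) x z g d hA hc hrun
  refine ⟨runningAverage (stepSize η) w,
    runningAverage_mem hc (convex_iInter hfX.convex_constraint) hw, fun p hp k hk => ?_⟩
  -- The averages run over 1, …, `k`; the extra index 0 in `range (k + 1)` only adds a nonnegative
  -- term.
  obtain ⟨h1, h2⟩ := hw' p hp (k + 1)
  have hk0 : 0 < √(k : ℝ) := Real.sqrt_pos.2 (by exact_mod_cast hk)
  have hlog : 0 ≤ Real.log k := Real.log_nonneg (by exact_mod_cast hk)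
  have hP : M * (1 + ∑ r ∈ Finset.range (k + 1), stepSize η r ^ 2)
      ≤ M * (1 + 2 * η ^ 2) * (1 + Real.log k) := by
    rw [mul_assoc]
    refine mul_le_mul_of_nonneg_left ?_ hM
    have := sum_stepSize_sq_le η hk
    linarith
  have hrate : ∀ q : ℝ, q ≤ M * (1 + 2 * η ^ 2) * (1 + Real.log k) →
      (stepSum (stepSize η) k)⁻¹ * q
        ≤ 2 / η * (M * (1 + 2 * η ^ 2)) * ((1 + Real.log k) / √(k : ℝ)) := by
    intro q hq
    have hS : (stepSum (stepSize η) k)⁻¹ ≤ 2 / η * (√(k : ℝ))⁻¹ := by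
      have h := inv_anti₀ (by positivity) (mul_sqrt_le_stepSum hη k)
      rwa [mul_inv, inv_div] at h
    calc (stepSum (stepSize η) k)⁻¹ * q
        ≤ (stepSum (stepSize η) k)⁻¹ * (M * (1 + 2 * η ^ 2) * (1 + Real.log k)) :=
          mul_le_mul_of_nonneg_left hq (inv_nonneg.2 (stepSum_pos hc hk).le)
      _ ≤ 2 / η * (√(k : ℝ))⁻¹ * (M * (1 + 2 * η ^ 2) * (1 + Real.log k)) :=
          mul_le_mul_of_nonneg_right hS (by positivity)
      _ = _ := by ring
  constructor
  · refine (map_runningAverage_sub_le hc (convexOn_objective hfX.convex_objective) w _ hk).trans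
      (hrate _ ((sum_Icc_le_sum_range (fun r => ?_) k).trans (h1.trans hP)))
    exact mul_nonneg (hc r).le (sub_nonneg.2 (hp.2 _ (hw r)))
  · intro i
    refine (norm_runningAverage_sub_le hc _ w hk).trans
      (hrate _ ((sum_Icc_le_sum_range (fun r => ?_) k).trans ((h2 i).trans hP)))
    exact mul_nonneg (hc r).le (norm_nonneg _)

theorem log_div_sqrt_isBigO :
    (fun k : ℕ => (1 + Real.log (k : ℝ)) / √(k : ℝ))
      =O[atTop] fun k : ℕ => Real.log (k : ℝ) / √(k : ℝ) := by
  refine IsBigO.of_bound 2 ?_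
  filter_upwards [eventually_ge_atTop 3] with k hk
  have hk3 : (3 : ℝ) ≤ k := by exact_mod_cast hk
  have hlog : 1 ≤ Real.log k := by
    rw [Real.le_log_iff_exp_le (by linarith)]
    have := Real.exp_one_lt_d9
    linarith
  rw [Real.norm_of_nonneg (by positivity), Real.norm_of_nonneg (by positivity), mul_div_assoc']
  gcongr
  linarith

theorem tendsto_log_div_sqrt :
    Tendsto (fun k : ℕ => Real.log (k : ℝ) / √(k : ℝ)) atTop (𝓝 0) := by
  have h := (isLittleO_log_rpow_atTop (show (0 : ℝ) < 1 / 2 by norm_num)).tendsto_div_nhds_zero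
  simp_rw [← Real.sqrt_eq_rpow] at h
  exact h.comp tendsto_natCast_atTop_atTop

end DistributedSubgradient

/-! ### The main theorem -/

theorem theorem2 {n m : ℕ}
    (f : Fin m → EuclideanSpace ℝ (Fin n) → ℝ)
    (X : Fin m → Set (EuclideanSpace ℝ (Fin n)))
    (hfX : DistributedSubgradient.ConvexCompactProblem f X)
    (η : ℝ) (hη : 0 < η)
    (θ : ℝ) (hθ : θ ∈ Set.Ioo (0 : ℝ) 1) (T : ℕ) :
    ∃ B₁ > (0 : ℝ), ∃ B₂ > (0 : ℝ),
      ∀ (A : ℕ → Matrix (Fin m) (Fin m) ℝ)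
        (x z g d : ℕ → Fin m → EuclideanSpace ℝ (Fin n))
        (xhat : Fin m → ℕ → EuclideanSpace ℝ (Fin n)),
        DistributedSubgradient.NetworkAssumptions A θ T →
        DistributedSubgradient.IsAlgorithmRun f X A (DistributedSubgradient.stepSize η) x z g d →
        (∀ i, xhat i = DistributedSubgradient.runningAverage
          (DistributedSubgradient.stepSize η) (fun k => x k i)) →
        (∀ i j,
          Tendsto (fun k : ℕ => ‖xhat i k - xhat j k‖) atTop (𝓝 0) ∧
          (fun k : ℕ => ‖xhat i k - xhat j k‖) =O[atTop]
            (fun k : ℕ => Real.log (k : ℝ) / √(k : ℝ))) ∧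
        (∀ i, ∀ p : EuclideanSpace ℝ (Fin n), MapClusterPt p atTop (xhat i) → p ∈ ⋂ j, X j) ∧
        (∀ xstar : EuclideanSpace ℝ (Fin n), DistributedSubgradient.IsOptimiser f X xstar →
          ∀ k : ℕ, 1 ≤ k →
            |∑ i, f i (xhat i k) - DistributedSubgradient.objective f xstar| ≤
              B₁ * (1 / √(k : ℝ)) + B₂ * (Real.log (k : ℝ) / √(k : ℝ))) := by
  obtain ⟨R, -, hR⟩ := DistributedSubgradient.exists_norm_le_of_mem hfX.compact_constraint
  obtain ⟨L, hL, hlip, -⟩ :=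
    DistributedSubgradient.exists_uniform_lipschitz_const hfX.convex_objective R
  obtain ⟨M, hM, hbound⟩ := DistributedSubgradient.exists_runningAverage_bound hfX hη hθ T
  -- Moving from the agents' averages to `v` costs `m * L * M`, the gap at `v` costs `M`, and the
  -- last 1 only ensures strict positivity.
  refine ⟨(m * L + 1) * M + 1, by positivity, (m * L + 1) * M + 1, by positivity,
    fun A x z g d xhat hA hrun hxhat => ?_⟩
  obtain ⟨v, hv, hv'⟩ := hbound A x z g d hA hrun
  simp_rw [← hxhat] at hv'
  have hdist : ∀ i, (fun k => xhat i k - v k)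
      =O[atTop] fun k : ℕ => Real.log (k : ℝ) / √(k : ℝ) := fun i => by
    obtain ⟨p, hp⟩ := DistributedSubgradient.exists_isOptimiser hfX i
    refine IsBigO.trans (IsBigO.of_bound M ?_) DistributedSubgradient.log_div_sqrt_isBigO
    filter_upwards [eventually_ge_atTop 1] with k hk
    exact ((hv' p hp k hk).2 i).trans (mul_le_mul_of_nonneg_left (Real.le_norm_self _) hM)
  have hxx : ∀ i j, (fun k : ℕ => ‖xhat i k - xhat j k‖)
      =O[atTop] fun k : ℕ => Real.log (k : ℝ) / √(k : ℝ) := fun i j => by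
    simpa using ((hdist i).sub (hdist j)).norm_left
  refine ⟨fun i j => ⟨(hxx i j).trans_tendsto DistributedSubgradient.tendsto_log_div_sqrt,
    hxx i j⟩, fun i p hp => ?_, fun p hp k hk => ?_⟩
  · have h0 := (hdist i).trans_tendsto DistributedSubgradient.tendsto_log_div_sqrt
    -- Along an ultrafilter realising the accumulation point, the feasible `v` has the same limit,
    -- and the intersection is closed.
    obtain ⟨U, hU, hUp⟩ := mapClusterPt_iff_ultrafilter.1 hp
    have hvp : Tendsto v U (𝓝 p) := by simpa using hUp.sub (h0.mono_left hU)
    exact (isClosed_iInter fun j => (hfX.compact_constraint j).isClosed).mem_of_tendsto hvp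
      (Eventually.of_forall hv)
  · obtain ⟨h1, h2⟩ := hv' p hp k hk
    -- The averages themselves may be infeasible with value below the optimum; feasibility of `v k`
    -- is what makes the bound two-sided.
    have h3 : 0 ≤ DistributedSubgradient.objective f (v k)
        - DistributedSubgradient.objective f p := sub_nonneg.2 (hp.2 _ (hv k))
    have hxX : ∀ i, xhat i k ∈ X i := fun i => by
      rw [hxhat]
      exact DistributedSubgradient.runningAverage_mem (DistributedSubgradient.stepSize_pos hη)
        (hfX.convex_constraint i) (fun r => hrun.mem r i) k
    set q := (1 + Real.log (k : ℝ)) / √(k : ℝ) with hq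
    have h4 : |∑ i, f i (xhat i k) - DistributedSubgradient.objective f (v k)|
        ≤ m * L * (M * q) := by
      rw [DistributedSubgradient.objective, ← Finset.sum_sub_distrib]
      calc |∑ i, (f i (xhat i k) - f i (v k))| ≤ ∑ i, |f i (xhat i k) - f i (v k)| :=
            Finset.abs_sum_le_sum_abs _ _
        _ ≤ ∑ i : Fin m, L * (M * q) := Finset.sum_le_sum fun i _ =>
            (hlip i _ _ (hR i _ (hxX i)) (hR i _ (Set.mem_iInter.1 (hv k) i))).trans
              (mul_le_mul_of_nonneg_left (h2 i) hL)
        _ = m * L * (M * q) := by simp [mul_assoc]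
    have hlog : 0 ≤ Real.log (k : ℝ) := Real.log_nonneg (by exact_mod_cast hk)
    have h5 : 0 ≤ q := by positivity
    have h6 : q = 1 / √(k : ℝ) + Real.log (k : ℝ) / √(k : ℝ) := add_div _ _ _
    rw [← mul_add, ← h6]
    calc |∑ i, f i (xhat i k) - DistributedSubgradient.objective f p|
        ≤ |∑ i, f i (xhat i k) - DistributedSubgradient.objective f (v k)|
          + |DistributedSubgradient.objective f (v k) - DistributedSubgradient.objective f p| :=
          abs_sub_le _ _ _
      _ ≤ m * L * (M * q) + M * q := by
          rw [abs_of_nonneg h3]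
          exact add_le_add h4 h1
      _ ≤ _ := by linarith
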